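/- Let $P$ be a poset, regarded as a category with a unique morphism $p\to q$ whenever $p\le q$. Let $X$ be the set of filters on $P$ (nonempty, downward directed, upward closed subsets), ordered by inclusion and equipped with the Scott topology. Identify each Grothendieck topology $J$ on $P$ with the subtopos $\mathrm{Sh}(P,J)$ of $\mathrm{PSh}(P)$. Write $\mathbf{p}=|P|$, $\mathbf{x}=|X|$, and let $\mathbf{gt}$ be the cardinality of the set of all Grothendieck topologies $J$ on $P$. Let $\mathbf{cl}$, $\mathbf{coh}$, $\mathbf{ep}$ be the cardinalities of the sets of those $J$ for which the subtopos $\mathrm{Sh}(P,J)$ is, respectively, closed; coherent; a topos with enough points. Here a subtopos is closed if, for some subterminal object $U$ of $\mathrm{PSh}(P)$, it consists of the presheaves $F$ for which the projection $F\times U\to U$ is an isomorphism. An object $E$ of a topos is compact if every epimorphic family with codomain $E$ contains a finite epimorphic subfamily. It is coherent if it is compact and, for all morphisms $E'\to E\leftarrow E''$ with $E',E''$ compact, the pullback $E'\times_E E''$ is compact. A topos is coherent if it contains a full subcategory of compact generators that is closed under finite limits. The subtopos $\mathrm{Sh}(P,J)$ is coherent if it is a coherent topos and sheafification $\mathrm{PSh}(P)\to\mathrm{Sh}(P,J)$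 preserves coherent objects. Suppose that $X$ is an infinite spectral space (sober, compact, and its compact open subsets are closed under binary intersections and form a basis). Then in the table $$\begin{array}{cccc} & & & 2^{(2^{\mathbf p})}\\ & & \mathbf{gt} & 2^{\mathbf{cl}}\\ & 2^{\mathbf p} & \mathbf{ep} & 2^{\mathbf x}\\ \mathbf{x} & \mathbf{cl} & \mathbf{coh} & 2^{\mathbf p} \end{array}$$ each cardinality is less than or equal to the cardinality directly to the right of it and to the cardinality directly above it, whenever there is one. That is: $$\mathbf{x}\le\mathbf{cl}\le\mathbf{coh}\le 2^{\mathbf p},\qquad 2^{\mathbf p}\le\mathbf{ep}\le 2^{\mathbf x},\qquad \mathbf{gt}\le 2^{\mathbf{cl}},$$ $$\mathbf{cl}\le 2^{\mathbf p},\qquad \mathbf{coh}\le\mathbf{ep}\le\mathbf{gt},\qquad 2^{\mathbf p}\le 2^{\mathbf x}\le 2^{\mathbf{cl}}\le 2^{(2^{\mathbf p})}.$$ -/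

import Mathlib

open CategoryTheory Limits Opposite Order

universe u v w

namespace PosetSites

/-! ### The dcpo of filters -/

/-- The set of filters on `P`, ordered by inclusion, with the Scott topology. -/
instance filterTopology (P : Type u) [PartialOrder P] : TopologicalSpace (PFilter P) :=
  Topology.scott (PFilter P) Set.univ

instance filterTopology_isScott (P : Type u) [PartialOrder P] :
    Topology.IsScott (PFilter P) Set.univ := ⟨rfl⟩

/-! ### Compact objects, coherent objects, coherent toposes -/

section Coherent

variable {C : Type w} [Category.{v} C]

/-- The family of morphisms `f i : A i ⟶ E` is (jointly) epimorphic. -/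
def IsEpimorphicFamily {ι : Type v} {A : ι → C} {E : C} (f : ∀ i, A i ⟶ E) : Prop :=
  ∀ ⦃Z : C⦄ (g h : E ⟶ Z), (∀ i, f i ≫ g = f i ≫ h) → g = h

/-- `E` is compact: every epimorphic family with codomain `E` contains a finite epimorphic
subfamily. -/
def IsCompactObj (E : C) : Prop :=
  ∀ ⦃ι : Type v⦄ (A : ι → C) (f : ∀ i, A i ⟶ E), IsEpimorphicFamily f →
    ∃ s : Finset ι, IsEpimorphicFamily (fun i : s => f i.1)

/-- `E` is coherent: it is compact, and any diagram `E' ⟶ E ⟵ E''` with `E'` and `E''` compact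
has a compact pullback. -/
def IsCoherentObj (E : C) : Prop :=
  IsCompactObj E ∧
    ∀ ⦃E' E'' Q : C⦄ (f : E' ⟶ E) (g : E'' ⟶ E) (fst : Q ⟶ E') (snd : Q ⟶ E''),
      IsCompactObj E' → IsCompactObj E'' → IsPullback fst snd f g → IsCompactObj Q

variable (C) in
/-- The topos `C` is coherent: it contains a full subcategory of compact generators that is closed
under finite limits. -/
def IsCoherentTopos : Prop :=
  ∃ K : ObjectProperty C,
    (∀ E : C, K E → IsCompactObj E) ∧ K.IsSeparating ∧
      ∀ (D : Type) [SmallCategory D] [FinCategory D], K.IsClosedUnderLimitsOfShape D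

end Coherent

/-! ### Subtoposes of presheaves on a poset

The subtopos of `Pᵒᵖ ⥤ Type u` given by a Grothendieck topology `J` on `P` is `Sheaf J (Type u)`;
its inclusion has sheafification as inverse image functor. -/

section Subtoposes

variable {P : Type u} [PartialOrder P]

/-- The subtopos of sheaves for `J` is closed: for some subterminal presheaf `U`, it consists of
the presheaves `F` such that the projection `F × U ⟶ U` is an isomorphism (so it is the closed
complement of the open subtopos given by `U`). -/
def IsClosedSubtopos (J : GrothendieckTopology P) : Prop :=
  ∃ U : Pᵒᵖ ⥤ Type u, IsSubterminal U ∧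
    ∀ F : Pᵒᵖ ⥤ Type u, Presheaf.IsSheaf J F ↔ IsIso (prod.snd : F ⨯ U ⟶ U)

/-- The subtopos of sheaves for `J` is coherent: it is a coherent topos, and the inverse image
functor of the inclusion preserves coherent objects. -/
def IsCoherentSubtopos (J : GrothendieckTopology P) : Prop :=
  IsCoherentTopos (Sheaf J (Type u)) ∧
    ∀ F : Pᵒᵖ ⥤ Type u, IsCoherentObj F → IsCoherentObj ((presheafToSheaf J (Type u)).obj F)

variable (P)

/-- The number of closed subtoposes. -/
def cl : Cardinal.{u} := Cardinal.mk {J : GrothendieckTopology P // IsClosedSubtopos J}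

/-- The number of coherent subtoposes. -/
def coh : Cardinal.{u} := Cardinal.mk {J : GrothendieckTopology P // IsCoherentSubtopos J}

/-- The number of subtoposes with enough points. -/
def ep : Cardinal.{u} :=
  Cardinal.mk {J : GrothendieckTopology P // GrothendieckTopology.HasEnoughPoints.{u} J}

/-- The number of Grothendieck topologies. -/
def gt : Cardinal.{u} := Cardinal.mk (GrothendieckTopology P)

/-- The number of elements of `P`. -/
def p : Cardinal.{u} := Cardinal.mk P

/-- The number of filters on `P`. -/
def x : Cardinal.{u} := Cardinal.mk (PFilter P)

end Subtoposes

end PosetSites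

/-! On a poset, a sieve on `p` is cut out by a lower set, so a Grothendieck topology amounts to a
relation `Covers` between lower sets and elements. Each inequality compares a class of such
relations with simpler data.

Every subset `A` of `P` gives a topology `ofSet A` for which the principal filters at elements of
`A` are enough points; as `A` can be recovered, `2 ^ p ≤ ep`. A topology with enough points is
determined by the filters that are its points, so `ep ≤ 2 ^ x`. The closed subtoposes are the `ofSet
Uᶜ` with `U` a lower set (`isClosedSubtopos_iff`). Complements of filters are lower sets, so `x ≤
cl`; and a topology is a set of pairs (lower set, element), of which there are at most `cl * cl =
cl`, so `gt ≤ 2 ^ cl`.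

Spectrality enters as two finiteness statements: `P` and all intersections of two principal lower
sets are finitely generated lower sets (`isFG_univ`, `isFG_Iic_inter_Iic`). In a closed subtopos,
compactness means finite generation away from `U`, so these statements make closed subtoposes
coherent: `cl ≤ coh`. They also make representable presheaves coherent, hence a coherent subtopos
has compact sheafified representables, and its topology is of finite type
(`IsCoherentSubtopos.isFiniteType`). Such a topology is determined by its finite covers, so `coh ≤ 2
^ p`, and has enough points by Deligne's argument, so `coh ≤ ep`. -/

namespace PosetSites

/-! ### Sieves and Grothendieck topologies on a poset -/

section Topologies

variable {P : Type u} [PartialOrder P]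

/-- The sieve on `p` cut out by a lower set. -/
def sieveOf (D : LowerSet P) (p : P) : Sieve p where
  arrows q _ := q ∈ D
  downward_closed hf g := D.lower (leOfHom g) hf

/-- The lower set of the domains of a sieve. -/
def support {p : P} (S : Sieve p) : LowerSet P where
  carrier := {q | ∃ f : q ⟶ p, S f}
  lower' := by
    rintro q r hrq ⟨f, hf⟩
    exact ⟨homOfLE hrq ≫ f, S.downward_closed hf _⟩

lemma sieveOf_support {p : P} (S : Sieve p) : sieveOf (support S) p = S := by
  ext q f
  refine ⟨fun ⟨g, hg⟩ ↦ ?_, fun hf ↦ ⟨f, hf⟩⟩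
  rwa [Subsingleton.elim f g]

/-- The lower set `D` covers `p`. -/
def Covers (J : GrothendieckTopology P) (D : LowerSet P) (p : P) : Prop :=
  sieveOf D p ∈ J p

lemma covers_support_iff (J : GrothendieckTopology P) {p : P} (S : Sieve p) :
    Covers J (support S) p ↔ S ∈ J p := by
  rw [Covers, sieveOf_support]

variable {J K : GrothendieckTopology P} {D E : LowerSet P} {p q : P}

lemma ext_of_covers (h : ∀ D p, Covers J D p ↔ Covers K D p) : J = K := by
  ext p S
  rw [← covers_support_iff, ← covers_support_iff, h]

lemma Covers.of_mem (h : p ∈ D) : Covers J D p := by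
  have : sieveOf D p = ⊤ := by
    ext q f
    exact ⟨fun _ ↦ trivial, fun _ ↦ D.lower (leOfHom f) h⟩
  rw [Covers, this]
  exact J.top_mem p

lemma Covers.of_le (h : Covers J D p) (hq : q ≤ p) : Covers J D q :=
  J.pullback_stable (homOfLE hq) h

lemma Covers.trans (h : Covers J D p) (h' : ∀ q ∈ D, q ≤ p → Covers J E q) : Covers J E p :=
  J.transitive h _ fun _ f hf ↦ h' _ hf (leOfHom f)

lemma Covers.mono (h : Covers J D p) (h' : ∀ q ∈ D, q ≤ p → q ∈ E) : Covers J E p :=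
  h.trans fun q hq hqp ↦ .of_mem (h' q hq hqp)

lemma Covers.inf (h : Covers J D p) (h' : Covers J E p) : Covers J (D ⊓ E) p :=
  h.trans fun _ hq hqp ↦ (h'.of_le hqp).mono fun _ hr hrq ↦ ⟨D.lower hrq hq, hr⟩

/-- The topology on `P` given by the subspace of principal filters generated by elements
of `A`. -/
def ofSet (A : Set P) : GrothendieckTopology P where
  sieves p := {S | ∀ a ∈ A, ∀ f : a ⟶ p, S f}
  top_mem' _ _ _ _ := trivial
  pullback_stable' _ _ _ f h a ha g := h a ha (g ≫ f)
  transitive' p S h R h' a ha f := by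
    simpa using h' (h a ha f) a ha (𝟙 a)

lemma covers_ofSet {A : Set P} : Covers (ofSet A) D p ↔ ∀ a ∈ A, a ≤ p → a ∈ D :=
  ⟨fun h a ha hap ↦ h a ha (homOfLE hap), fun h a ha f ↦ h a ha (leOfHom f)⟩

/-- The set `A` is recovered from its topology: `p` lies in `A` exactly when the elements strictly
below `p` fail to cover `p`. -/
lemma ofSet_injective : Function.Injective (ofSet : Set P → GrothendieckTopology P) := by
  have key (A : Set P) (p : P) : p ∈ A ↔ ¬ Covers (ofSet A) (LowerSet.Iio p) p := by
    rw [covers_ofSet]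
    refine ⟨fun hp h ↦ lt_irrefl p (h p hp le_rfl), fun h ↦ ?_⟩
    by_contra hp
    exact h fun a ha hap ↦ lt_of_le_of_ne hap fun hh ↦ hp (hh ▸ ha)
  intro A B h
  ext p
  rw [key, key, h]

/-- A topology of finite type: each covering lower set contains a covering lower set that is
finitely generated. -/
def IsFiniteType (J : GrothendieckTopology P) : Prop :=
  ∀ D p, Covers J D p → ∃ T : Finset P, (∀ q ∈ T, q ∈ D) ∧ Covers J (lowerClosure T) p

lemma IsFiniteType.eq (hJ : IsFiniteType J) (hK : IsFiniteType K)
    (h : ∀ (T : Finset P) p, Covers J (lowerClosure T) p ↔ Covers K (lowerClosure T) p) :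
    J = K := by
  have key {T : Finset P} {D : LowerSet P} (hT : ∀ q ∈ T, q ∈ D) (r : P)
      (hr : r ∈ lowerClosure (T : Set P)) : r ∈ D := by
    obtain ⟨q, hq, hrq⟩ := hr
    exact D.lower hrq (hT q hq)
  refine ext_of_covers fun D p ↦ ⟨fun hD ↦ ?_, fun hD ↦ ?_⟩
  · obtain ⟨T, hT, hT'⟩ := hJ D p hD
    exact ((h T p).1 hT').mono fun r hr _ ↦ key hT r hr
  · obtain ⟨T, hT, hT'⟩ := hK D p hD
    exact ((h T p).2 hT').mono fun r hr _ ↦ key hT r hr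

end Topologies

/-! ### Points -/

section Points

variable {P : Type u} [PartialOrder P]

/-- The filter `F` is a point of the site `(P, J)`. -/
def IsPointOf (J : GrothendieckTopology P) (F : PFilter P) : Prop :=
  ∀ D p, Covers J D p → p ∈ F → ∃ q ∈ F, q ∈ D ∧ q ≤ p

/-- The fiber functor of the point given by a filter. -/
def fiberFunctor (F : PFilter P) : P ⥤ Type u where
  obj p := ULift.{u} (PLift (p ∈ F))
  map f := ↾fun x ↦ ⟨⟨PFilter.mem_of_le (leOfHom f) x.down.down⟩⟩

instance (F : PFilter P) (p : P) : Subsingleton ((fiberFunctor F).obj p) :=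
  inferInstanceAs (Subsingleton (ULift.{u} (PLift (p ∈ F))))

instance (F : PFilter P) : IsCofiltered (fiberFunctor F).Elements where
  nonempty := by
    obtain ⟨p, hp⟩ := F.nonempty
    exact ⟨⟨p, ⟨⟨hp⟩⟩⟩⟩
  cone_objs := by
    rintro ⟨p, x⟩ ⟨q, y⟩
    obtain ⟨r, hr, hrp, hrq⟩ := F.directed p x.down.down q y.down.down
    exact ⟨⟨r, ⟨⟨hr⟩⟩⟩, CategoryOfElements.homMk _ _ (homOfLE hrp) (Subsingleton.elim _ _),
      CategoryOfElements.homMk _ _ (homOfLE hrq) (Subsingleton.elim _ _), trivial⟩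
  cone_maps := by
    intro X Y f g
    exact ⟨X, 𝟙 X, CategoryOfElements.ext _ _ _ (Subsingleton.elim _ _)⟩

/-- The point of the site `(P, J)` given by a filter. -/
def pointOfFilter {J : GrothendieckTopology P} (F : {F : PFilter P // IsPointOf J F}) :
    GrothendieckTopology.Point.{u} J where
  fiber := fiberFunctor F.1
  initiallySmall := initiallySmall_of_essentiallySmall _
  jointly_surjective {p} S hS x := by
    obtain ⟨q, hq, ⟨f, hf⟩, -⟩ := F.2 _ p ((covers_support_iff J S).2 hS) x.down.down
    exact ⟨q, f, hf, ⟨⟨hq⟩⟩, Subsingleton.elim _ _⟩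

lemma hasEnoughPoints_of_filters {J : GrothendieckTopology P}
    (h : ∀ D p, ¬ Covers J D p → ∃ F : PFilter P, IsPointOf J F ∧ p ∈ F ∧ ∀ q ∈ F, q ∉ D) :
    GrothendieckTopology.HasEnoughPoints.{u} J where
  exists_objectProperty := by
    refine ⟨.ofObj (pointOfFilter (J := J)), inferInstance, .mk' ?_⟩
    intro p S hS
    by_contra hp
    rw [← covers_support_iff] at hp
    obtain ⟨F, hF, hpF, hF'⟩ := h _ p hp
    obtain ⟨q, f, hf, y, -⟩ := hS ⟨pointOfFilter ⟨F, hF⟩, ⟨_⟩⟩ ⟨⟨hpF⟩⟩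
    exact hF' q y.down.down ⟨f, hf⟩

/-- Two elements of a fiber are images of a common third one, along parallel morphisms of a poset,
which are equal. Hence a point carries no more information than a filter. -/
lemma subsingleton_fiber {J : GrothendieckTopology P} (Φ : GrothendieckTopology.Point.{u} J)
    (p : P) : Subsingleton (Φ.fiber.obj p) where
  allEq x y := by
    obtain ⟨Z, f, g, -⟩ := IsCofilteredOrEmpty.cone_objs (C := Φ.fiber.Elements) ⟨p, x⟩ ⟨p, y⟩
    have hfg : f.1 = g.1 := Subsingleton.elim _ _
    have hf : Φ.fiber.map f.1 Z.2 = x := f.2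
    have hg : Φ.fiber.map g.1 Z.2 = y := g.2
    rw [← hf, ← hg, hfg]

/-- The filter of those elements of `P` at which the fiber functor of a point is inhabited. -/
def filterOfPoint {J : GrothendieckTopology P} (Φ : GrothendieckTopology.Point.{u} J) :
    PFilter P :=
  IsPFilter.toPFilter (F := {p | Nonempty (Φ.fiber.obj p)}) <| by
    refine .of_def ?_ ?_ ?_
    · obtain ⟨p, x⟩ := (IsCofiltered.nonempty : Nonempty Φ.fiber.Elements)
      exact ⟨p, ⟨x⟩⟩
    · rintro p ⟨x⟩ q ⟨y⟩
      obtain ⟨Z, f, g, -⟩ :=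
        IsCofilteredOrEmpty.cone_objs (C := Φ.fiber.Elements) ⟨p, x⟩ ⟨q, y⟩
      exact ⟨Z.1, ⟨Z.2⟩, leOfHom f.1, leOfHom g.1⟩
    · rintro p q hpq ⟨x⟩
      exact ⟨Φ.fiber.map (homOfLE hpq) x⟩

lemma isPointOf_filterOfPoint {J : GrothendieckTopology P}
    (Φ : GrothendieckTopology.Point.{u} J) : IsPointOf J (filterOfPoint Φ) := by
  rintro D p hD ⟨x⟩
  obtain ⟨q, f, hf, y, -⟩ := Φ.jointly_surjective _ hD x
  exact ⟨q, ⟨y⟩, hf, leOfHom f⟩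

lemma covers_iff_of_hasEnoughPoints {J : GrothendieckTopology P}
    (hJ : GrothendieckTopology.HasEnoughPoints.{u} J) (D : LowerSet P) (p : P) :
    Covers J D p ↔ ∀ F, IsPointOf J F → p ∈ F → ∃ q ∈ F, q ∈ D ∧ q ≤ p := by
  refine ⟨fun h F hF ↦ hF D p h, fun h ↦ ?_⟩
  obtain ⟨Q, _, hQ⟩ := hJ.exists_objectProperty
  have := (hQ.jointly_reflect_ofArrows_mem (X := p) (ι := {q : P // q ∈ D ∧ q ≤ p})
    (fun q ↦ homOfLE q.2.2)).2 fun Φ x ↦ by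
      obtain ⟨q, ⟨y⟩, hq⟩ := h _ (isPointOf_filterOfPoint Φ.obj) ⟨x⟩
      have := subsingleton_fiber Φ.obj p
      exact ⟨⟨q, hq⟩, y, Subsingleton.elim _ _⟩
  refine J.superset_covering ?_ this
  rintro r f ⟨s, g, _, ⟨q⟩, -⟩
  exact D.lower (leOfHom g) q.2.1

lemma hasEnoughPoints_ofSet (A : Set P) : GrothendieckTopology.HasEnoughPoints.{u} (ofSet A) := by
  refine hasEnoughPoints_of_filters fun D p h ↦ ?_
  simp only [covers_ofSet, not_forall] at h
  obtain ⟨a, ha, hap, haD⟩ := h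
  refine ⟨.principal a, fun E q hE hq ↦ ?_, hap, fun q hq hqD ↦ haD (D.lower hq hqD)⟩
  exact ⟨a, le_rfl, covers_ofSet.1 hE a ha hq, hq⟩

/-- Deligne's theorem for sites on posets. -/
lemma IsFiniteType.hasEnoughPoints {J : GrothendieckTopology P} (hJ : IsFiniteType J) :
    GrothendieckTopology.HasEnoughPoints.{u} J := by
  refine hasEnoughPoints_of_filters fun D p h ↦ ?_
  let closure (E : LowerSet P) : LowerSet P :=
    ⟨{q | Covers J E q}, fun q r hrq hq ↦ Covers.of_le hq hrq⟩
  -- Zorn is applied to the `J`-closed lower sets avoiding `p`. Finite type keeps the union of a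
  -- chain closed, since a finite cover already lies in one member. The complement of a maximal
  -- member is the required filter.
  let 𝒮 : Set (LowerSet P) := {M | (∀ q, Covers J M q → q ∈ M) ∧ p ∉ M}
  have closure_mem (E : LowerSet P) (hE : ¬ Covers J E p) : closure E ∈ 𝒮 :=
    ⟨fun q hq ↦ hq.trans fun r hr _ ↦ hr, hE⟩
  have hchain : ∀ c ⊆ 𝒮, IsChain (· ≤ ·) c → ∀ y ∈ c, ∃ ub ∈ 𝒮, ∀ z ∈ c, z ≤ ub := by
    intro c hc hcc y hy
    refine ⟨sSup c, ⟨fun q hq ↦ ?_, fun hp ↦ ?_⟩, fun z hz ↦ le_sSup hz⟩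
    · obtain ⟨T, hT, hTq⟩ := hJ _ _ hq
      obtain ⟨M, hM, hTM⟩ : ∃ M ∈ c, ∀ q ∈ T, q ∈ M := by
        clear hTq
        induction T using Finset.cons_induction with
        | empty => exact ⟨y, hy, by simp⟩
        | cons a T _ ih =>
          obtain ⟨M, hM, hTM⟩ := ih fun q hq ↦ hT q (Finset.mem_cons_of_mem hq)
          obtain ⟨N, hN, haN⟩ := LowerSet.mem_sSup_iff.1 (hT a (Finset.mem_cons_self a T))
          rcases hcc.total hM hN with hMN | hNM
          · exact ⟨N, hN, by
              simpa using ⟨haN, fun q hq ↦ hMN (hTM q hq)⟩⟩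
          · exact ⟨M, hM, by
              simpa using ⟨hNM haN, hTM⟩⟩
      refine LowerSet.mem_sSup_iff.2 ⟨M, hM, (hc hM).1 q (hTq.mono ?_)⟩
      rintro r ⟨s, hs, hrs⟩ -
      exact M.lower hrs (hTM s hs)
    · obtain ⟨M, hM, hpM⟩ := LowerSet.mem_sSup_iff.1 hp
      exact (hc hM).2 hpM
  obtain ⟨M, hDM, hM⟩ := zorn_le_nonempty₀ 𝒮 hchain _ (closure_mem D h)
  -- By maximality, the closure of `M ⊔ Iic q` must contain `p`. Intersecting two such covers shows
  -- that `M` is prime, so that its complement is downward directed.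
  have hcov {q : P} (hq : q ∉ M) : Covers J (M ⊔ LowerSet.Iic q) p := by
    by_contra hp
    refine hq (hM.le_of_ge (closure_mem _ hp) (fun r hr ↦ ?_) ?_)
    · exact Covers.of_mem (Or.inl hr)
    · exact Covers.of_mem (Or.inr le_rfl)
  refine ⟨IsPFilter.toPFilter (F := {q | q ∉ M}) (.of_def ⟨p, hM.prop.2⟩ ?_ ?_), ?_, hM.prop.2, ?_⟩
  · intro q hq r hr
    by_contra! hqr
    refine hM.prop.2 (hM.prop.1 p (((hcov hq).inf (hcov hr)).mono ?_))
    rintro s ⟨hs | hs, hs' | hs'⟩ -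
    · exact hs
    · exact hs
    · exact hs'
    · by_contra hsM
      exact hqr s hsM hs hs'
  · exact fun hqr hq hr ↦ hq (M.lower hqr hr)
  · intro E q hE (hq : q ∉ M)
    by_contra! hE'
    refine hq (hM.prop.1 q (hE.mono fun r hr hrq ↦ ?_))
    by_contra hrM
    exact hE' r hrM hr hrq
  · exact fun q hq hqD ↦ hq (hDM (Covers.of_mem hqD))

end Points

/-! ### Finitely generated subsets and spectrality of the space of filters -/

section FinitelyGenerated

variable {P : Type u} [PartialOrder P]

/-- Away from `U`, the set `D` is generated under `≥` by a finite subset of `D`. -/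
def IsFG (U : Set P) (D : Set P) : Prop :=
  ∃ T : Set P, T.Finite ∧ T ⊆ D ∧ ∀ r ∈ D, r ∉ U → ∃ t ∈ T, r ≤ t

lemma IsFG.mono {U V D : Set P} (h : IsFG U D) (hUV : U ⊆ V) : IsFG V D := by
  obtain ⟨T, hT, hTD, h⟩ := h
  exact ⟨T, hT, hTD, fun r hr hrV ↦ h r hr fun hrU ↦ hrV (hUV hrU)⟩

lemma IsFG.inter {U D E : Set P} (hP : ∀ p q : P, IsFG U (Set.Iic p ∩ Set.Iic q))
    (hD : IsFG U D) (hE : IsFG U E) (hD' : IsLowerSet D) (hE' : IsLowerSet E) :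
    IsFG U (D ∩ E) := by
  obtain ⟨S, hS, hSD, hSD'⟩ := hD
  obtain ⟨T, hT, hTE, hTE'⟩ := hE
  choose R hR hRs hR' using hP
  refine ⟨⋃ s ∈ S, ⋃ t ∈ T, R s t, hS.biUnion fun s _ ↦ hT.biUnion fun t _ ↦ hR s t, ?_, ?_⟩
  · simp only [Set.iUnion_subset_iff]
    exact fun s hs t ht r hr ↦ ⟨hD' (hRs s t hr).1 (hSD hs), hE' (hRs s t hr).2 (hTE ht)⟩
  · rintro r ⟨hrD, hrE⟩ hrU
    obtain ⟨s, hs, hrs⟩ := hSD' r hrD hrU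
    obtain ⟨t, ht, hrt⟩ := hTE' r hrE hrU
    obtain ⟨a, ha, hra⟩ := hR' s t r ⟨hrs, hrt⟩ hrU
    exact ⟨a, Set.mem_biUnion hs (Set.mem_biUnion ht ha), hra⟩

/-- The filters that contain `p`. -/
def basicOpen (p : P) : Set (PFilter P) := {F | p ∈ F}

lemma isOpen_basicOpen (p : P) : IsOpen (basicOpen p) := by
  rw [Topology.IsScott.isOpen_iff_isUpperSet_and_dirSupInaccOn (D := Set.univ)]
  refine ⟨fun F G hFG hF ↦ hFG hF, ?_⟩
  intro d _ hd hd' F hF hpF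
  have hub : IsPFilter (⋃ G ∈ d, (G : Set P)) := by
    refine .of_def ?_ ?_ ?_
    · obtain ⟨G, hG⟩ := hd
      obtain ⟨q, hq⟩ := G.nonempty
      exact ⟨q, Set.mem_biUnion hG hq⟩
    · intro q hq r hr
      simp only [Set.mem_iUnion, exists_prop] at hq hr
      obtain ⟨G, hG, hq⟩ := hq
      obtain ⟨H, hH, hr⟩ := hr
      obtain ⟨K, hK, hGK, hHK⟩ := hd' G hG H hH
      obtain ⟨s, hs, hsq, hsr⟩ := K.directed q (hGK hq) r (hHK hr)
      exact ⟨s, Set.mem_biUnion hK hs, hsq, hsr⟩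
    · intro q r hqr hq
      simp only [Set.mem_iUnion, exists_prop] at hq ⊢
      obtain ⟨G, hG, hq⟩ := hq
      exact ⟨G, hG, PFilter.mem_of_le hqr hq⟩
  have hle : F ≤ hub.toPFilter := hF.2 fun G hG q hq ↦ Set.mem_biUnion hG hq
  obtain ⟨G, hG, hp⟩ := Set.mem_iUnion₂.1 (hle hpF)
  exact ⟨G, hG, hp⟩

/-- The principal filter at `p` is the least element of `basicOpen p`, and Scott open sets are upper
sets, so one member of a cover suffices. -/
lemma isCompact_basicOpen (p : P) : IsCompact (basicOpen p) := by
  refine isCompact_of_finite_subcover fun {ι} V hV hpV ↦ ?_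
  obtain ⟨i, hi⟩ := Set.mem_iUnion.1 (hpV (show PFilter.principal p ∈ basicOpen p from le_rfl))
  have hup := ((Topology.IsScott.isOpen_iff_isUpperSet_and_dirSupInaccOn
    (D := Set.univ)).1 (hV i)).1
  exact ⟨{i}, fun F hF ↦ Set.mem_biUnion (Finset.mem_singleton_self i)
    (hup (PFilter.principal_le_iff.2 hF) hi)⟩

lemma isFG_of_isCompact {D : Set P} (h : IsCompact (⋃ p ∈ D, basicOpen p)) : IsFG ∅ D := by
  obtain ⟨T, hTD, hT, hT'⟩ := h.elim_finite_subcover_image (b := D) (c := basicOpen)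
    (fun p _ ↦ isOpen_basicOpen p) subset_rfl
  refine ⟨T, hT, hTD, fun r hr _ ↦ ?_⟩
  obtain ⟨t, ht, hrt⟩ := Set.mem_iUnion₂.1
    (hT' (Set.mem_biUnion hr (show PFilter.principal r ∈ basicOpen r from le_rfl)))
  exact ⟨t, ht, hrt⟩

lemma isFG_univ [CompactSpace (PFilter P)] : IsFG ∅ (Set.univ : Set P) := by
  refine isFG_of_isCompact ?_
  convert (isCompact_univ : IsCompact (Set.univ : Set (PFilter P)))
  refine Set.eq_univ_of_forall fun F ↦ ?_
  obtain ⟨p, hp⟩ := F.nonempty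
  exact Set.mem_biUnion (Set.mem_univ p) hp

lemma isFG_Iic_inter_Iic [QuasiSeparatedSpace (PFilter P)] (p q : P) :
    IsFG ∅ (Set.Iic p ∩ Set.Iic q) := by
  refine isFG_of_isCompact ?_
  convert QuasiSeparatedSpace.inter_isCompact _ _ (isOpen_basicOpen p) (isCompact_basicOpen p)
    (isOpen_basicOpen q) (isCompact_basicOpen q) using 1
  ext F
  simp only [Set.mem_iUnion, exists_prop]
  constructor
  · rintro ⟨r, ⟨hrp, hrq⟩, hr⟩
    exact ⟨PFilter.mem_of_le hrp hr, PFilter.mem_of_le hrq hr⟩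
  · rintro ⟨hp, hq⟩
    obtain ⟨r, hr, hrp, hrq⟩ := F.directed p hp q hq
    exact ⟨r, ⟨hrp, hrq⟩, hr⟩

end FinitelyGenerated

/-! ### Compact and coherent objects -/

section Objects

variable {P : Type u} [PartialOrder P]

/-- Restriction of a section of a presheaf on a poset. -/
def res (F : Pᵒᵖ ⥤ Type u) {p q : P} (h : q ≤ p) (x : F.obj (op p)) : F.obj (op q) :=
  F.map (homOfLE h).op x

lemma res_self (F : Pᵒᵖ ⥤ Type u) {p : P} (x : F.obj (op p)) : res F le_rfl x = x :=
  ConcreteCategory.congr_hom (F.map_id (op p)) x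

lemma res_res (F : Pᵒᵖ ⥤ Type u) {p q r : P} (h : q ≤ p) (h' : r ≤ q) (x : F.obj (op p)) :
    res F h' (res F h x) = res F (h'.trans h) x :=
  (ConcreteCategory.congr_hom (F.map_comp (homOfLE h).op (homOfLE h').op) x).symm

lemma app_res {F G : Pᵒᵖ ⥤ Type u} (φ : F ⟶ G) {p q : P} (h : q ≤ p) (x : F.obj (op p)) :
    φ.app (op q) (res F h x) = res G h (φ.app (op p) x) :=
  φ.naturality_apply (homOfLE h).op x

/-- The elements of `P` over which the sections `x` and `y` agree. -/
def eqLocus (F : Pᵒᵖ ⥤ Type u) {p q : P} (x : F.obj (op p)) (y : F.obj (op q)) : Set P :=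
  {r | ∃ (h : r ≤ p) (h' : r ≤ q), res F h x = res F h' y}

/-- The presheaf whose sections over `p` are the sets of elements of `P` below `p` and
outside `U`. -/
def subsetPresheaf (U : LowerSet P) : Pᵒᵖ ⥤ Type u where
  obj p := {S : Set P // ∀ q ∈ S, q ≤ p.unop ∧ q ∉ U}
  map {_ p} _ := ↾fun S ↦ ⟨{q | q ∈ S.1 ∧ q ≤ p.unop}, fun q hq ↦ ⟨hq.2, (S.2 q hq.1).2⟩⟩
  map_id p := by
    ext S q
    change (q ∈ S.1 ∧ q ≤ p.unop) ↔ q ∈ S.1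
    exact ⟨fun hq ↦ hq.1, fun hq ↦ ⟨hq, (S.2 q hq).1⟩⟩
  map_comp {p p' p''} f g := by
    ext S q
    change (q ∈ S.1 ∧ q ≤ p''.unop) ↔ (q ∈ S.1 ∧ q ≤ p'.unop) ∧ q ≤ p''.unop
    exact ⟨fun hq ↦ ⟨⟨hq.1, hq.2.trans (leOfHom g.unop)⟩, hq.2⟩, fun hq ↦ ⟨hq.1.1, hq.2⟩⟩

/-- The subterminal presheaf given by a lower set. -/
def subterminalPresheaf (D : LowerSet P) : Pᵒᵖ ⥤ Type u where
  obj p := ULift.{u} (PLift (p.unop ∈ D))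
  map f := ↾fun x ↦ ⟨⟨D.lower (leOfHom f.unop) x.down.down⟩⟩

instance (D : LowerSet P) (p : Pᵒᵖ) : Subsingleton ((subterminalPresheaf D).obj p) :=
  inferInstanceAs (Subsingleton (ULift.{u} (PLift (p.unop ∈ D))))

variable {C : Type w} [Category.{u} C]

/-- The functor `i` identifies `C` with the category of those presheaves that have exactly one
section over each element of `U`. -/
structure IsComplementInclusion (U : LowerSet P) (i : C ⥤ Pᵒᵖ ⥤ Type u) : Prop where
  full : i.Full
  faithful : i.Faithful
  unique (E : C) (p : P) (hp : p ∈ U) : Nonempty (Unique ((i.obj E).obj (op p)))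
  exists_iso (F : Pᵒᵖ ⥤ Type u) (hF : ∀ p ∈ U, Nonempty (Unique (F.obj (op p)))) :
    ∃ E : C, Nonempty (i.obj E ≅ F)

/-- The presheaf `F` is generated, away from `U`, by finitely many sections. -/
def HasFiniteGenerators (U : LowerSet P) (F : Pᵒᵖ ⥤ Type u) : Prop :=
  ∃ T : Set (Σ p : P, F.obj (op p)), T.Finite ∧ (∀ t ∈ T, t.1 ∉ U) ∧
    ∀ p ∉ U, ∀ x : F.obj (op p), ∃ t ∈ T, ∃ h : p ≤ t.1, res F h t.2 = x

lemma hasFiniteGenerators_iff_of_subsingleton {U : LowerSet P} {F : Pᵒᵖ ⥤ Type u}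
    [∀ p, Subsingleton (F.obj p)] :
    HasFiniteGenerators U F ↔ IsFG (U : Set P) {p | Nonempty (F.obj (op p))} := by
  constructor
  · rintro ⟨T, hT, -, h⟩
    refine ⟨Sigma.fst '' T, hT.image _, ?_, ?_⟩
    · rintro _ ⟨t, _, rfl⟩
      exact ⟨t.2⟩
    · rintro r ⟨x⟩ hr
      obtain ⟨t, ht, hrt, -⟩ := h r hr x
      exact ⟨t.1, ⟨t, ht, rfl⟩, hrt⟩
  · rintro ⟨T, hT, hTF, h⟩
    refine ⟨{t | t.1 ∈ T ∧ t.1 ∉ U}, ?_, fun t ht ↦ ht.2, ?_⟩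
    · refine Set.Finite.of_injOn (f := Sigma.fst) (fun t ht ↦ ht.1) ?_ hT
      rintro ⟨p, x⟩ - ⟨q, y⟩ - (rfl : p = q)
      rw [Subsingleton.elim x y]
    · intro p hp x
      obtain ⟨t, ht, hpt⟩ := h p ⟨x⟩ hp
      obtain ⟨y⟩ := hTF ht
      exact ⟨⟨t, y⟩, ⟨ht, fun htU ↦ hp (U.lower hpt htU)⟩, hpt, Subsingleton.elim _ _⟩

namespace IsComplementInclusion

variable {U : LowerSet P} {i : C ⥤ Pᵒᵖ ⥤ Type u} (hi : IsComplementInclusion U i)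
include hi

lemma hom_ext {A B : C} {f g : A ⟶ B}
    (h : ∀ p ∉ U, ∀ x, (i.map f).app (op p) x = (i.map g).app (op p) x) : f = g := by
  have := hi.faithful
  apply i.map_injective
  ext ⟨p⟩ x
  by_cases hp : p ∈ U
  · obtain ⟨_⟩ := hi.unique B p hp
    exact Subsingleton.elim _ _
  · exact h p hp x

lemma isEpimorphicFamily_iff {ι : Type u} {A : ι → C} {E : C} (f : ∀ k, A k ⟶ E) :
    IsEpimorphicFamily f ↔ ∀ p ∉ U, ∀ x : (i.obj E).obj (op p),
      ∃ k, ∃ y, (i.map (f k)).app (op p) y = x := by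
  constructor
  · intro h
    have := hi.full
    -- The test object: over `U` its only section is the empty set. The map `φ` records where a
    -- section is hit by the family and `ψ` records everything outside `U`; they agree on every `f
    -- k`, hence coincide.
    obtain ⟨Z, ⟨e⟩⟩ := hi.exists_iso (subsetPresheaf U) fun p hp ↦
      ⟨⟨⟨∅, by simp⟩⟩, fun S ↦ Subtype.ext (Set.eq_empty_of_forall_notMem fun q hq ↦
        (S.2 q hq).2 (U.lower (S.2 q hq).1 hp))⟩
    let φ : i.obj E ⟶ subsetPresheaf U :=
      { app p := ↾fun x ↦ ⟨{q | q ∉ U ∧ ∃ (h : q ≤ p.unop) (k : ι) (y : _),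
          (i.map (f k)).app (op q) y = res (i.obj E) h x}, fun q hq ↦ ⟨hq.2.1, hq.1⟩⟩
        naturality p p' g := by
          ext x
          refine Subtype.ext (Set.ext fun q ↦ ?_)
          constructor
          · rintro ⟨hq, h, k, y, hy⟩
            exact ⟨⟨hq, h.trans (leOfHom g.unop), k, y, hy.trans (res_res _ (leOfHom g.unop) h x)⟩,
              h⟩
          · rintro ⟨⟨hq, _, k, y, hy⟩, h⟩
            exact ⟨hq, h, k, y, hy.trans (res_res _ (leOfHom g.unop) h x).symm⟩ }
    let ψ : i.obj E ⟶ subsetPresheaf U :=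
      { app p := ↾fun x ↦ ⟨{q | q ≤ p.unop ∧ q ∉ U}, fun q hq ↦ hq⟩
        naturality p p' g := by
          ext x
          exact Subtype.ext (Set.ext fun q ↦
            ⟨fun hq ↦ ⟨⟨hq.1.trans (leOfHom g.unop), hq.2⟩, hq.1⟩, fun hq ↦ ⟨hq.2, hq.1.2⟩⟩) }
    have key : i.preimage (φ ≫ e.inv) = i.preimage (ψ ≫ e.inv) := by
      refine h _ _ fun k ↦ hi.hom_ext fun p hp y ↦ ?_
      have : φ.app (op p) ((i.map (f k)).app (op p) y) =
          ψ.app (op p) ((i.map (f k)).app (op p) y) := by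
        refine Subtype.ext (Set.ext fun q ↦ ⟨fun hq ↦ ⟨hq.2.1, hq.1⟩, fun hq ↦ ?_⟩)
        exact ⟨hq.2, hq.1, k, res _ hq.1 y, app_res _ _ _⟩
      simpa using congrArg (e.inv.app (op p)) this
    intro p hp x
    have key' : φ = ψ := by
      rw [← cancel_mono e.inv]
      simpa using congrArg i.map key
    have hx : p ∈ (φ.app (op p) x).1 := by
      rw [key']
      exact ⟨le_rfl, hp⟩
    obtain ⟨-, _, k, y, hy⟩ := hx
    exact ⟨k, y, hy.trans (res_self _ x)⟩
  · intro h Z g g' hg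
    refine hi.hom_ext fun p hp x ↦ ?_
    obtain ⟨k, y, rfl⟩ := h p hp x
    have := ConcreteCategory.congr_hom (NatTrans.congr_app (congrArg i.map (hg k)) (op p)) y
    simpa using this

/-- Each section is the image of the generating section of a subterminal object. -/
lemma exists_generator {E : C} {p : P} (x : (i.obj E).obj (op p)) :
    ∃ (A : C) (f : A ⟶ E) (a : (i.obj A).obj (op p)), (i.map f).app (op p) a = x ∧
      (∀ q, Subsingleton ((i.obj A).obj q)) ∧ ∀ q ∉ U, (i.obj A).obj (op q) → q ≤ p := by
  have := hi.full
  obtain ⟨A, ⟨e⟩⟩ := hi.exists_iso (subterminalPresheaf (LowerSet.Iic p ⊔ U)) fun q hq ↦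
    ⟨⟨⟨⟨⟨Or.inr hq⟩⟩⟩, fun _ ↦ Subsingleton.elim _ _⟩⟩
  let u (q : P) (hq : q ∈ U) : Unique ((i.obj E).obj (op q)) := (hi.unique E q hq).some
  classical
  -- Below `p` the value is the restriction of `x`; elsewhere `q` lies in `U`, where the section is
  -- unique.
  let val (q : P) (y : (subterminalPresheaf (LowerSet.Iic p ⊔ U)).obj (op q)) :
      (i.obj E).obj (op q) :=
    if h : q ≤ p then res _ h x else (u q (y.down.down.resolve_left h)).default
  have hval (q : P) (h : q ≤ p) (y) : val q y = res _ h x := dif_pos h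
  let φ : subterminalPresheaf (LowerSet.Iic p ⊔ U) ⟶ i.obj E :=
    { app q := ↾(val q.unop)
      naturality q r g := by
        ext y
        by_cases hr : r.unop ∈ U
        · exact @Subsingleton.elim _ (u r.unop hr).instSubsingleton _ _
        · have hrp : r.unop ≤ p :=
            ((subterminalPresheaf (LowerSet.Iic p ⊔ U)).map g y).down.down.resolve_right hr
          have hqp : q.unop ≤ p :=
            y.down.down.resolve_right fun hq ↦ hr (U.lower (leOfHom g.unop) hq)
          exact (hval _ hrp ((subterminalPresheaf (LowerSet.Iic p ⊔ U)).map g y)).trans ((res_res _ hqp (leOfHom g.unop) x).symm.trans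
            (congrArg ((i.obj E).map g) (hval _ hqp y).symm)) }
  refine ⟨A, i.preimage (e.hom ≫ φ), e.inv.app (op p) ⟨⟨Or.inl le_rfl⟩⟩, ?_, fun q ↦ ?_, ?_⟩
  · have h1 : φ.app (op p) ⟨⟨Or.inl le_rfl⟩⟩ = x :=
      (hval p le_rfl ⟨⟨Or.inl le_rfl⟩⟩).trans (res_self _ x)
    have h2 := ConcreteCategory.congr_hom (NatTrans.congr_app e.inv_hom_id (op p))
      ⟨⟨Or.inl le_rfl⟩⟩
    refine Eq.trans ?_ h1
    rw [i.map_preimage]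
    exact congrArg (φ.app (op p)) h2
  · exact (e.app q).toEquiv.subsingleton
  · exact fun q hq y ↦ (e.hom.app (op q) y).down.down.resolve_right hq

lemma isCompactObj_iff (E : C) : IsCompactObj E ↔ HasFiniteGenerators U (i.obj E) := by
  constructor
  · intro h
    choose A f a ha _ hA using
      fun t : Σ p : {p : P // p ∉ U}, (i.obj E).obj (op p.1) ↦ hi.exists_generator t.2
    obtain ⟨s, hs⟩ := h A f ((hi.isEpimorphicFamily_iff f).2 fun p hp x ↦
      ⟨⟨⟨p, hp⟩, x⟩, a ⟨⟨p, hp⟩, x⟩, ha ⟨⟨p, hp⟩, x⟩⟩)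
    rw [hi.isEpimorphicFamily_iff] at hs
    refine ⟨(fun t : Σ p : {p : P // p ∉ U}, (i.obj E).obj (op p.1) ↦ ⟨t.1.1, t.2⟩) '' s,
      s.finite_toSet.image _, ?_, fun p hp x ↦ ?_⟩
    · rintro _ ⟨t, -, rfl⟩
      exact t.1.2
    · obtain ⟨⟨t, ht⟩, y, hy⟩ := hs p hp x
      have hpt := hA t p hp y
      refine ⟨_, ⟨t, ht, rfl⟩, hpt, ?_⟩
      rw [← hy, ← ha t, ← app_res]
      congr 1
      exact Subsingleton.elim _ _
  · rintro ⟨T, hT, hTU, h⟩ ι A f hf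
    rw [hi.isEpimorphicFamily_iff] at hf
    choose k y hy using fun t : T ↦ hf t.1.1 (hTU _ t.2) t.1.2
    have := hT.to_subtype
    refine ⟨(Set.finite_range k).toFinset, (hi.isEpimorphicFamily_iff _).2 fun p hp x ↦ ?_⟩
    obtain ⟨t, ht, hpt, rfl⟩ := h p hp x
    refine ⟨⟨k ⟨t, ht⟩, by simp⟩, res _ hpt (y ⟨t, ht⟩), ?_⟩
    rw [app_res]
    exact congrArg _ (hy ⟨t, ht⟩)

/-- Compact objects are generated by finitely many sections, and the pullback of two objects
generated by single sections is, away from `U`, the subterminal object supported on their `eqLocus`.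
So testing these loci is enough. -/
lemma isCoherentObj_iff [HasPullbacks C] [PreservesLimitsOfShape WalkingCospan i] (E : C) :
    IsCoherentObj E ↔ HasFiniteGenerators U (i.obj E) ∧
      ∀ (p q : P) (x : (i.obj E).obj (op p)) (y : (i.obj E).obj (op q)), p ∉ U → q ∉ U →
        IsFG (U : Set P) (eqLocus (i.obj E) x y) := by
  have ev {E' E'' Q : C} {f : E' ⟶ E} {g : E'' ⟶ E} {fst : Q ⟶ E'} {snd : Q ⟶ E''}
      (h : IsPullback fst snd f g) (p : P) := (h.map i).map ((evaluation _ _).obj (op p))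
  rw [IsCoherentObj, hi.isCompactObj_iff]
  refine and_congr_right fun _ ↦ ⟨?_, ?_⟩
  · intro h p q x y hp hq
    obtain ⟨A, f, a, rfl, _, hA⟩ := hi.exists_generator x
    obtain ⟨B, g, b, rfl, _, hB⟩ := hi.exists_generator y
    have hcA : IsCompactObj A := (hi.isCompactObj_iff A).2 ⟨{⟨p, a⟩}, Set.finite_singleton _,
      fun t ht ↦ by rwa [Set.mem_singleton_iff.1 ht], fun r hr z ↦
        ⟨_, rfl, hA r hr z, Subsingleton.elim _ _⟩⟩
    have hcB : IsCompactObj B := (hi.isCompactObj_iff B).2 ⟨{⟨q, b⟩}, Set.finite_singleton _,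
      fun t ht ↦ by rwa [Set.mem_singleton_iff.1 ht], fun r hr z ↦
        ⟨_, rfl, hB r hr z, Subsingleton.elim _ _⟩⟩
    have hQ := IsPullback.of_hasPullback f g
    obtain ⟨T, hT, hTU, h⟩ := (hi.isCompactObj_iff _).1 (h f g _ _ hcA hcB hQ)
    refine ⟨Sigma.fst '' T, hT.image _, ?_, ?_⟩
    · rintro _ ⟨t, ht, rfl⟩
      have htp := hA _ (hTU t ht) ((i.map (pullback.fst f g)).app _ t.2)
      have htq := hB _ (hTU t ht) ((i.map (pullback.snd f g)).app _ t.2)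
      refine ⟨htp, htq, ?_⟩
      rw [← app_res, ← app_res,
        Subsingleton.elim (res _ htp a) ((i.map (pullback.fst f g)).app _ t.2),
        Subsingleton.elim (res _ htq b) ((i.map (pullback.snd f g)).app _ t.2)]
      exact ConcreteCategory.congr_hom (ev hQ t.1).w t.2
    · rintro r ⟨hrp, hrq, hr⟩ hrU
      rw [← app_res, ← app_res] at hr
      obtain ⟨z, -⟩ := Types.exists_of_isPullback (ev hQ r) _ _ hr
      obtain ⟨t, ht, hrt, -⟩ := h r hrU z
      exact ⟨t.1, ⟨t, ht, rfl⟩, hrt⟩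
  · intro h E' E'' Q f g fst snd hE' hE'' hQ
    rw [hi.isCompactObj_iff] at hE' hE'' ⊢
    obtain ⟨T', hT', hTU', h'⟩ := hE'
    obtain ⟨T'', hT'', hTU'', h''⟩ := hE''
    choose S hS hSsub hS' using fun (t : T' × T'') ↦ h _ _ ((i.map f).app _ t.1.1.2)
      ((i.map g).app _ t.2.1.2) (hTU' _ t.1.2) (hTU'' _ t.2.2)
    have hz (s : Σ t : T' × T'', {r // r ∈ S t ∧ r ∉ U}) : ∃ z : (i.obj Q).obj (op s.2.1),
        ∃ (h : s.2.1 ≤ s.1.1.1.1) (h' : s.2.1 ≤ s.1.2.1.1),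
          (i.map fst).app _ z = res _ h s.1.1.1.2 ∧ (i.map snd).app _ z = res _ h' s.1.2.1.2 := by
      obtain ⟨h, h', heq⟩ := hSsub s.1 s.2.2.1
      rw [← app_res, ← app_res] at heq
      obtain ⟨z, hz, hz'⟩ := Types.exists_of_isPullback (ev hQ _) _ _ heq
      exact ⟨z, h, h', hz, hz'⟩
    choose z hz₁ hz₂ hzf hzs using hz
    have := hT'.to_subtype
    have := hT''.to_subtype
    have (t : T' × T'') : Finite {r // r ∈ S t ∧ r ∉ U} :=
      ((hS t).subset (show {r | r ∈ S t ∧ r ∉ U} ⊆ S t from fun r hr ↦ hr.1)).to_subtype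
    refine ⟨Set.range fun s ↦ ⟨s.2.1, z s⟩, Set.finite_range _, ?_, fun r hr c ↦ ?_⟩
    · rintro _ ⟨s, rfl⟩
      exact s.2.2.2
    · obtain ⟨t', ht', hrt', hc'⟩ := h' r hr ((i.map fst).app _ c)
      obtain ⟨t'', ht'', hrt'', hc''⟩ := h'' r hr ((i.map snd).app _ c)
      obtain ⟨s, hs, hrs⟩ := hS' (⟨t', ht'⟩, ⟨t'', ht''⟩) r ⟨hrt', hrt'', by
        rw [← app_res, ← app_res, hc', hc'']
        exact ConcreteCategory.congr_hom (ev hQ r).w c⟩ hr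
      let s' : Σ t : T' × T'', {r // r ∈ S t ∧ r ∉ U} :=
        ⟨(⟨t', ht'⟩, ⟨t'', ht''⟩), s, hs, fun hsU ↦ hr (U.lower hrs hsU)⟩
      refine ⟨_, ⟨s', rfl⟩, hrs, Types.ext_of_isPullback (ev hQ r) ?_ ?_⟩
      · refine (app_res (i.map fst) hrs (z s')).trans ?_
        exact (congrArg (res _ hrs) (hzf s')).trans ((res_res _ _ _ _).trans hc')
      · refine (app_res (i.map snd) hrs (z s')).trans ?_
        exact (congrArg (res _ hrs) (hzs s')).trans ((res_res _ _ _ _).trans hc'')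

/-- The compact subterminal objects serve as generators. The support of a finite limit is the
intersection of the supports: `huniv` treats the empty intersection and `hinter` the binary step. -/
lemma isCoherentTopos [∀ (D : Type) [SmallCategory D] [FinCategory D],
    PreservesLimitsOfShape D i] (huniv : IsFG (U : Set P) Set.univ)
    (hinter : ∀ p q : P, IsFG (U : Set P) (Set.Iic p ∩ Set.Iic q)) : IsCoherentTopos C := by
  refine ⟨fun E ↦ IsCompactObj E ∧ ∀ p, Subsingleton ((i.obj E).obj p), fun E hE ↦ hE.1, ?_, ?_⟩
  · intro E Z g g' hg
    refine hi.hom_ext fun p hp x ↦ ?_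
    obtain ⟨A, f, a, rfl, hA, hA'⟩ := hi.exists_generator x
    have hcA : IsCompactObj A := (hi.isCompactObj_iff A).2 ⟨{⟨p, a⟩}, Set.finite_singleton _,
      fun t ht ↦ by rwa [Set.mem_singleton_iff.1 ht], fun r hr z ↦
        ⟨_, rfl, hA' r hr z, Subsingleton.elim _ _⟩⟩
    have := ConcreteCategory.congr_hom
      (NatTrans.congr_app (congrArg i.map (hg A ⟨hcA, hA⟩ f)) (op p)) a
    simpa using this
  · intro D _ _
    refine ⟨fun X ⟨h⟩ ↦ ?_⟩
    have hlim (p : P) := (Types.isLimit_iff _).1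
      ⟨isLimitOfPreserves ((evaluation _ _).obj (op p)) (isLimitOfPreserves i h.isLimit)⟩
    have hsub (d : D) (p : Pᵒᵖ) : Subsingleton ((i.obj (h.diag.obj d)).obj p) :=
      (h.prop_diag_obj d).2 p
    have hX (p : Pᵒᵖ) : Subsingleton ((i.obj X).obj p) := by
      refine ⟨fun x y ↦ ?_⟩
      let c := ((evaluation _ _).obj p).mapCone (i.mapCone (Cone.mk X h.π))
      exact (hlim p.unop (fun d ↦ c.π.app d x)
        fun {d d'} f ↦ ConcreteCategory.congr_hom (c.w f) x).unique (fun d ↦ rfl)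
        fun d ↦ @Subsingleton.elim _ (hsub d p) _ _
    refine ⟨?_, hX⟩
    rw [hi.isCompactObj_iff, hasFiniteGenerators_iff_of_subsingleton]
    have hXd : {p | Nonempty ((i.obj X).obj (op p))} =
        ⋂ d ∈ (Finset.univ : Finset D), {p | Nonempty ((i.obj (h.diag.obj d)).obj (op p))} := by
      ext p
      simp only [Finset.mem_univ, Set.iInter_true, Set.mem_iInter, Set.mem_ofPred_eq]
      refine ⟨fun ⟨x⟩ d ↦ ⟨(i.map (h.π.app d)).app (op p) x⟩, fun hp ↦ ?_⟩
      obtain ⟨x, -⟩ := hlim p (fun d ↦ (hp d).some)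
        fun {d d'} f ↦ @Subsingleton.elim _ (hsub d' (op p)) _ _
      exact ⟨x⟩
    rw [hXd]
    have hlow (d : D) : IsLowerSet {p | Nonempty ((i.obj (h.diag.obj d)).obj (op p))} :=
      fun p q hqp ⟨x⟩ ↦ ⟨res _ hqp x⟩
    induction (Finset.univ : Finset D) using Finset.cons_induction with
    | empty => simpa using huniv
    | cons d s _ ih =>
      simp only [Finset.mem_cons, Set.iInter_iInter_eq_or_left]
      refine IsFG.inter hinter ?_ ih (hlow d) (isLowerSet_iInter₂ fun d _ ↦ hlow d)
      rw [← hasFiniteGenerators_iff_of_subsingleton, ← hi.isCompactObj_iff]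
      exact (h.prop_diag_obj d).1

end IsComplementInclusion

end Objects

/-! ### Closed subtoposes -/

section Closed

variable {P : Type u} [PartialOrder P]

/-- The empty sieve covers each element of `U`, while an element outside `U` is covered only by the
maximal sieve. -/
lemma isSheaf_ofSet_compl_iff (U : LowerSet P) (F : Pᵒᵖ ⥤ Type u) :
    Presheaf.IsSheaf (ofSet (U : Set P)ᶜ) F ↔ ∀ p ∈ U, Nonempty (Unique (F.obj (op p))) := by
  rw [isSheaf_iff_isSheaf_of_type]
  constructor
  · intro h p hp
    have hbot : (⊥ : Sieve p) ∈ ofSet (U : Set P)ᶜ p := fun a ha f ↦ ha (U.lower (leOfHom f) hp)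
    obtain ⟨x, -, hx⟩ := h ⊥ hbot (fun _ _ hf ↦ hf.elim) (fun _ _ _ _ _ _ _ hf ↦ hf.elim)
    exact ⟨⟨⟨x⟩, fun y ↦ hx y fun _ _ hf ↦ hf.elim⟩⟩
  · intro h p S hS
    by_cases hp : p ∈ U
    · intro x _
      obtain ⟨y⟩ := h p hp
      refine ⟨y.default, fun q f hf ↦ ?_, fun z _ ↦ Subsingleton.elim _ _⟩
      obtain ⟨_⟩ := h q (U.lower (leOfHom f) hp)
      exact Subsingleton.elim _ _
    · have : S = ⊤ := Sieve.id_mem_iff_eq_top.1 (hS p hp (𝟙 p))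
      rw [this]
      exact Presieve.isSheafFor_top F

lemma isIso_prod_snd_iff {F V : Pᵒᵖ ⥤ Type u} (hV : ∀ p, Subsingleton (V.obj p)) :
    IsIso (prod.snd : F ⨯ V ⟶ V) ↔
      ∀ p, Nonempty (V.obj (op p)) → Nonempty (Unique (F.obj (op p))) := by
  rw [NatTrans.isIso_iff_isIso_app]
  refine ⟨fun h p ⟨v⟩ ↦ ?_, fun h p ↦ ?_⟩
  · have hb := (isIso_iff_bijective _).1 (h (op p))
    obtain ⟨z, -⟩ := hb.2 v
    refine ⟨⟨⟨(prod.fst : F ⨯ V ⟶ F).app _ z⟩, fun x ↦ ?_⟩⟩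
    have : FunctorToTypes.prodMk x v = z := hb.1 (Subsingleton.elim _ _)
    rw [← this]
    exact (FunctorToTypes.prodMk_fst x v).symm
  · rw [isIso_iff_bijective]
    refine ⟨fun z z' _ ↦ ?_, fun v ↦ ?_⟩
    · obtain ⟨_⟩ := h p.unop ⟨(prod.snd : F ⨯ V ⟶ V).app _ z⟩
      apply (FunctorToTypes.binaryProductEquiv F V p).injective
      exact Prod.ext (Subsingleton.elim (α := F.obj (op p.unop)) _ _) (Subsingleton.elim _ _)
    · obtain ⟨x⟩ := h p.unop ⟨v⟩
      exact ⟨FunctorToTypes.prodMk x.default v, Subsingleton.elim _ _⟩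

lemma subsingleton_of_isSubterminal {V : Pᵒᵖ ⥤ Type u} (hV : IsSubterminal V) (p : Pᵒᵖ) :
    Subsingleton (V.obj p) where
  allEq x y := yonedaEquiv.symm.injective (hV (yonedaEquiv.symm x) (yonedaEquiv.symm y))

lemma isClosedSubtopos_iff (J : GrothendieckTopology P) :
    IsClosedSubtopos J ↔ ∃ U : LowerSet P, J = ofSet (U : Set P)ᶜ := by
  constructor
  · rintro ⟨V, hV, h⟩
    have hV' := subsingleton_of_isSubterminal hV
    refine ⟨⟨{p | Nonempty (V.obj (op p))}, fun p q hqp ⟨x⟩ ↦ ⟨res V hqp x⟩⟩,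
      topology_eq_iff_same_sheaves.2 fun F ↦ ?_⟩
    rw [← isSheaf_iff_isSheaf_of_type, ← isSheaf_iff_isSheaf_of_type, h, isIso_prod_snd_iff hV',
      isSheaf_ofSet_compl_iff]
    rfl
  · rintro ⟨U, rfl⟩
    refine ⟨subterminalPresheaf U, fun Z f g ↦ ?_, fun F ↦ ?_⟩
    · ext p x
      exact Subsingleton.elim _ _
    · rw [isSheaf_ofSet_compl_iff, isIso_prod_snd_iff (fun p ↦ inferInstance)]
      exact forall_congr' fun p ↦ ⟨fun h ⟨x⟩ ↦ h x.down.down, fun h hp ↦ h ⟨⟨⟨hp⟩⟩⟩⟩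

lemma isComplementInclusion_sheafToPresheaf (U : LowerSet P) :
    IsComplementInclusion U (sheafToPresheaf (ofSet (U : Set P)ᶜ) (Type u)) where
  full := inferInstance
  faithful := inferInstance
  unique E p hp := (isSheaf_ofSet_compl_iff U _).1 E.property p hp
  exists_iso F hF := ⟨⟨F, (isSheaf_ofSet_compl_iff U F).2 hF⟩, ⟨Iso.refl _⟩⟩

lemma isComplementInclusion_id :
    IsComplementInclusion (⊥ : LowerSet P) (𝟭 (Pᵒᵖ ⥤ Type u)) where
  full := inferInstance
  faithful := inferInstance
  unique _ _ hp := hp.elim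
  exists_iso F _ := ⟨F, ⟨Iso.refl _⟩⟩

/-- Outside `U` only maximal sieves cover, so local injectivity and local surjectivity hold on the
nose. Finite generation away from `U` thus passes from `F` to its sheafification. -/
lemma bijective_toSheafify_app (U : LowerSet P) (F : Pᵒᵖ ⥤ Type u) {p : P} (hp : p ∉ U) :
    Function.Bijective ((toSheafify (ofSet (U : Set P)ᶜ) F).app (op p)) := by
  constructor
  · intro x y hxy
    have := Presheaf.equalizerSieve_mem (ofSet (U : Set P)ᶜ)
      (toSheafify (ofSet (U : Set P)ᶜ) F) x y hxy p hp (𝟙 p)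
    simpa using this
  · intro x
    obtain ⟨y, hy⟩ := Presheaf.imageSieve_mem (ofSet (U : Set P)ᶜ) (toSheafify _ F) x p hp (𝟙 p)
    exact ⟨y, hy.trans (res_self (sheafify (ofSet (U : Set P)ᶜ) F) x)⟩

lemma IsClosedSubtopos.isCoherentSubtopos [SpectralSpace (PFilter P)]
    {J : GrothendieckTopology P} (hJ : IsClosedSubtopos J) : IsCoherentSubtopos J := by
  obtain ⟨U, rfl⟩ := (isClosedSubtopos_iff J).1 hJ
  have hi := isComplementInclusion_sheafToPresheaf U
  refine ⟨hi.isCoherentTopos (isFG_univ.mono (Set.empty_subset _))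
    fun p q ↦ (isFG_Iic_inter_Iic p q).mono (Set.empty_subset _), fun F hF ↦ ?_⟩
  rw [(isComplementInclusion_id (P := P)).isCoherentObj_iff] at hF
  rw [hi.isCoherentObj_iff]
  obtain ⟨⟨T, hT, -, hTF⟩, hF⟩ := hF
  let η := toSheafify (ofSet (U : Set P)ᶜ) F
  constructor
  · refine ⟨{t | ∃ t' ∈ T, t'.1 ∉ U ∧ ⟨t'.1, η.app _ t'.2⟩ = t}, ?_, ?_, fun p hp x ↦ ?_⟩
    · refine (hT.image fun t' ↦ ⟨t'.1, η.app _ t'.2⟩).subset ?_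
      rintro _ ⟨t', ht', -, rfl⟩
      exact ⟨t', ht', rfl⟩
    · rintro _ ⟨t', -, ht', rfl⟩
      exact ht'
    · obtain ⟨y, rfl⟩ := (bijective_toSheafify_app U F hp).2 x
      obtain ⟨t, ht, hpt, rfl⟩ := hTF p (fun h ↦ h) y
      exact ⟨_, ⟨t, ht, fun h ↦ hp (U.lower hpt h), rfl⟩, hpt, (app_res η hpt t.2).symm⟩
  · intro p q x y hp hq
    obtain ⟨x, rfl⟩ := (bijective_toSheafify_app U F hp).2 x
    obtain ⟨y, rfl⟩ := (bijective_toSheafify_app U F hq).2 y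
    obtain ⟨S, hS, hSsub, hS'⟩ := hF p q x y (fun h ↦ h) (fun h ↦ h)
    refine ⟨S, hS, fun r hr ↦ ?_, ?_⟩
    · obtain ⟨h, h', heq⟩ := hSsub hr
      exact ⟨h, h', (app_res η h x).symm.trans ((congrArg _ heq).trans (app_res η h' y))⟩
    · rintro r ⟨h, h', heq⟩ hr
      refine hS' r ⟨h, h', (bijective_toSheafify_app U F hr).1 ?_⟩ (fun h ↦ h)
      exact (app_res η h x).trans (heq.trans (app_res η h' y).symm)

end Closed

/-! ### Coherent subtoposes are of finite type -/

section FiniteType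

variable {P : Type u} [PartialOrder P]

lemma isCoherentObj_yoneda [QuasiSeparatedSpace (PFilter P)] (p : P) :
    IsCoherentObj (yoneda.obj p) := by
  rw [(isComplementInclusion_id (P := P)).isCoherentObj_iff]
  constructor
  · exact ⟨{⟨p, 𝟙 p⟩}, Set.finite_singleton _, fun _ _ h ↦ h, fun q _ (f : q ⟶ p) ↦
      ⟨⟨p, 𝟙 p⟩, rfl, leOfHom f, Subsingleton.elim (α := q ⟶ p) _ _⟩⟩
  · intro q r x y _ _
    convert (isFG_Iic_inter_Iic q r).mono (Set.empty_subset _)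
    ext s
    exact ⟨fun ⟨h, h', _⟩ ↦ ⟨h, h'⟩, fun ⟨h, h'⟩ ↦ ⟨h, h', Subsingleton.elim (α := s ⟶ p) _ _⟩⟩

/-- Morphisms from the sheafification of a representable presheaf are sections. -/
noncomputable def sheafifyYonedaEquiv (J : GrothendieckTopology P) (p : P)
    (Z : Sheaf J (Type u)) :
    ((presheafToSheaf J (Type u)).obj (yoneda.obj p) ⟶ Z) ≃ Z.obj.obj (op p) :=
  ((sheafificationAdjunction J (Type u)).homEquiv _ _).trans yonedaEquiv

lemma sheafifyYonedaEquiv_naturality (J : GrothendieckTopology P) {p q : P} (f : q ⟶ p)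
    (Z : Sheaf J (Type u)) (g : (presheafToSheaf J (Type u)).obj (yoneda.obj p) ⟶ Z) :
    sheafifyYonedaEquiv J q Z ((presheafToSheaf J (Type u)).map (yoneda.map f) ≫ g) =
      Z.obj.map f.op (sheafifyYonedaEquiv J p Z g) := by
  simp only [sheafifyYonedaEquiv, Equiv.trans_apply, Adjunction.homEquiv_naturality_left]
  exact (yonedaEquiv_naturality _ f).symm

/-- Sheaves are separated, so the sheafified representables at the elements of a cover of `p` form
an epimorphic family over that of `p`, which is compact. A finite epimorphic subfamily comes from a
finite cover. -/
lemma IsCoherentSubtopos.isFiniteType [QuasiSeparatedSpace (PFilter P)]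
    {J : GrothendieckTopology P} (hJ : IsCoherentSubtopos J) : IsFiniteType J := by
  intro D p hD
  let a := presheafToSheaf J (Type u)
  let ι := {q : P // q ∈ D ∧ q ≤ p}
  let f (q : ι) : a.obj (yoneda.obj q.1) ⟶ a.obj (yoneda.obj p) :=
    a.map (yoneda.map (homOfLE q.2.2))
  have hf : IsEpimorphicFamily f := by
    intro Z g h hgh
    apply (sheafifyYonedaEquiv J p Z).injective
    have hsep := ((isSheaf_iff_isSheaf_of_type _ _).1 Z.property).isSeparated _ hD
    refine hsep.ext fun q k hk ↦ ?_
    have := congrArg (sheafifyYonedaEquiv J q Z) (hgh ⟨q, hk, leOfHom k⟩)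
    rwa [sheafifyYonedaEquiv_naturality, sheafifyYonedaEquiv_naturality] at this
  obtain ⟨s, hs⟩ := (hJ.2 _ (isCoherentObj_yoneda p)).1 _ f hf
  classical
  refine ⟨s.image Subtype.val, ?_, ?_⟩
  · intro q hq
    obtain ⟨t, -, rfl⟩ := Finset.mem_image.1 hq
    exact t.2.1
  set S := sieveOf (lowerClosure ((s.image Subtype.val : Finset P) : Set P)) p
  -- In the sheaf of closed sieves, the closure of `S` and the maximal sieve agree on the finite
  -- subfamily. Being epimorphic, it forces them to be equal, which says that `S` covers `p`.
  let Z : Sheaf J (Type u) :=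
    ⟨(Functor.closedSieves J).toFunctor, (isSheaf_iff_isSheaf_of_type _ _).2 (classifier_isSheaf J)⟩
  let z₁ : Z.obj.obj (op p) := ⟨J.close S, J.close_isClosed S⟩
  let z₂ : Z.obj.obj (op p) := ⟨(⊤ : Sieve p), fun _ _ _ ↦ trivial⟩
  have key : (sheafifyYonedaEquiv J p Z).symm z₁ = (sheafifyYonedaEquiv J p Z).symm z₂ := by
    refine hs _ _ fun q ↦ (sheafifyYonedaEquiv J q.1.1 Z).injective ?_
    rw [sheafifyYonedaEquiv_naturality, sheafifyYonedaEquiv_naturality, Equiv.apply_symm_apply,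
      Equiv.apply_symm_apply]
    refine Subtype.ext ?_
    change (J.close S).pullback _ = (⊤ : Sieve p).pullback _
    rw [Sieve.pullback_top]
    exact Sieve.pullback_eq_top_of_mem _ (J.le_close S _
      (subset_lowerClosure (Finset.mem_coe.2 (Finset.mem_image_of_mem _ q.2))))
  have h := congrArg Subtype.val ((sheafifyYonedaEquiv J p Z).symm.injective key)
  exact (J.close_eq_top_iff_mem S).1 h

end FiniteType

/-! ### Cardinalities -/

section Cardinalities

variable (P : Type u) [PartialOrder P]

lemma p_le_x : p P ≤ x P :=
  Cardinal.mk_le_of_injective (f := fun p : P ↦ PFilter.principal p) fun _ _ h ↦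
    le_antisymm (PFilter.principal_le_principal_iff.1 h.ge)
      (PFilter.principal_le_principal_iff.1 h.le)

lemma infinite_of_infinite_pfilter [Infinite (PFilter P)] : Infinite P := by
  by_contra h
  rw [not_infinite_iff_finite] at h
  have : Finite (PFilter P) := Finite.of_injective (fun F : PFilter P ↦ (F : Set P))
    SetLike.coe_injective
  exact not_finite (PFilter P)

lemma mk_lowerSet_le_cl : Cardinal.mk (LowerSet P) ≤ cl P :=
  Cardinal.mk_le_of_injective
    (f := fun U ↦ ⟨ofSet (U : Set P)ᶜ, (isClosedSubtopos_iff _).2 ⟨U, rfl⟩⟩) fun _ _ h ↦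
      SetLike.coe_injective (compl_injective (ofSet_injective (congrArg Subtype.val h)))

lemma x_le_cl : x P ≤ cl P :=
  (Cardinal.mk_le_of_injective (f := fun F : PFilter P ↦
    (⟨(F : Set P)ᶜ, fun _ _ h hp hq ↦ hp (PFilter.mem_of_le h hq)⟩ : LowerSet P))
    fun _ _ h ↦ SetLike.coe_injective (compl_injective (congrArg LowerSet.carrier h))).trans
    (mk_lowerSet_le_cl P)

lemma cl_le_coh [SpectralSpace (PFilter P)] : cl P ≤ coh P :=
  Cardinal.mk_subtype_mono fun _ hJ ↦ IsClosedSubtopos.isCoherentSubtopos hJ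

lemma coh_le_two_power_p [Infinite P] [QuasiSeparatedSpace (PFilter P)] : coh P ≤ 2 ^ p P := by
  have h : coh P ≤ Cardinal.mk (Set (Finset P × P)) :=
    Cardinal.mk_le_of_injective
      (f := fun J ↦ {t : Finset P × P | Covers J.1 (lowerClosure t.1) t.2}) fun J K hJK ↦
        Subtype.ext (J.2.isFiniteType.eq K.2.isFiniteType fun T p ↦
          Set.ext_iff.1 hJK (T, p))
  refine h.trans_eq ?_
  rw [Cardinal.mk_set, Cardinal.mk_prod, Cardinal.lift_id, Cardinal.lift_id,
    Cardinal.mk_finset_of_infinite, Cardinal.mul_eq_self (Cardinal.aleph0_le_mk P), p]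

lemma coh_le_ep [QuasiSeparatedSpace (PFilter P)] : coh P ≤ ep P :=
  Cardinal.mk_subtype_mono fun _ hJ ↦ (IsCoherentSubtopos.isFiniteType hJ).hasEnoughPoints

lemma two_power_p_le_ep : 2 ^ p P ≤ ep P := by
  rw [p, ← Cardinal.mk_set]
  exact Cardinal.mk_le_of_injective (f := fun A ↦ ⟨ofSet A, hasEnoughPoints_ofSet A⟩)
    fun A B h ↦ ofSet_injective (congrArg Subtype.val h)

lemma ep_le_two_power_x : ep P ≤ 2 ^ x P := by
  rw [x, ← Cardinal.mk_set]
  refine Cardinal.mk_le_of_injective (f := fun J ↦ {F | IsPointOf J.1 F}) fun J K h ↦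
    Subtype.ext (ext_of_covers fun D p ↦ ?_)
  rw [covers_iff_of_hasEnoughPoints J.2, covers_iff_of_hasEnoughPoints K.2]
  exact forall_congr' fun F ↦ imp_congr_left (Set.ext_iff.1 h F)

lemma ep_le_gt : ep P ≤ gt P := Cardinal.mk_subtype_le _

lemma gt_le_two_power_cl [Infinite (PFilter P)] : gt P ≤ 2 ^ cl P := by
  have hcl : Cardinal.aleph0 ≤ cl P := (Cardinal.aleph0_le_mk (PFilter P)).trans (x_le_cl P)
  have h : gt P ≤ Cardinal.mk (Set (LowerSet P × P)) :=
    Cardinal.mk_le_of_injective (f := fun J ↦ {t : LowerSet P × P | Covers J t.1 t.2})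
      fun J K hJK ↦ ext_of_covers fun D p ↦ Set.ext_iff.1 hJK (D, p)
  refine h.trans ?_
  rw [Cardinal.mk_set, Cardinal.mk_prod, Cardinal.lift_id, Cardinal.lift_id]
  refine Cardinal.power_le_power_left two_ne_zero ?_
  rw [← Cardinal.mul_eq_self hcl]
  exact mul_le_mul' (mk_lowerSet_le_cl P) ((p_le_x P).trans (x_le_cl P))

end Cardinalities

end PosetSites

theorem mainTheorem5 (P : Type u) [PartialOrder P]
    (hinf : Infinite (PFilter P)) (hspec : SpectralSpace (PFilter P)) :
    -- bottom row, from left to right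
    PosetSites.x P ≤ PosetSites.cl P ∧
    PosetSites.cl P ≤ PosetSites.coh P ∧
    PosetSites.coh P ≤ 2 ^ PosetSites.p P ∧
    -- from the bottom row to the one above it
    PosetSites.cl P ≤ 2 ^ PosetSites.p P ∧
    PosetSites.coh P ≤ PosetSites.ep P ∧
    (2 : Cardinal.{u}) ^ PosetSites.p P ≤ 2 ^ PosetSites.x P ∧
    -- second row
    2 ^ PosetSites.p P ≤ PosetSites.ep P ∧
    PosetSites.ep P ≤ 2 ^ PosetSites.x P ∧
    -- from the second row to the third
    PosetSites.ep P ≤ PosetSites.gt P ∧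
    (2 : Cardinal.{u}) ^ PosetSites.x P ≤ 2 ^ PosetSites.cl P ∧
    -- third row
    PosetSites.gt P ≤ 2 ^ PosetSites.cl P ∧
    -- from the third row to the top
    (2 : Cardinal.{u}) ^ PosetSites.cl P ≤ 2 ^ ((2 : Cardinal.{u}) ^ PosetSites.p P) := by
  have := PosetSites.infinite_of_infinite_pfilter P
  have hx := PosetSites.x_le_cl P
  have hcl := PosetSites.cl_le_coh P
  have hcoh := PosetSites.coh_le_two_power_p P
  exact ⟨hx, hcl, hcoh, hcl.trans hcoh, PosetSites.coh_le_ep P,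
    Cardinal.power_le_power_left two_ne_zero (PosetSites.p_le_x P),
    PosetSites.two_power_p_le_ep P, PosetSites.ep_le_two_power_x P, PosetSites.ep_le_gt P,
    Cardinal.power_le_power_left two_ne_zero hx, PosetSites.gt_le_two_power_cl P,
    Cardinal.power_le_power_left two_ne_zero (hcl.trans hcoh)⟩
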